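/- Let $n\ge 1$. On the tangent bundle of $\mathbb R\times\mathbb R^n$ use coordinates $(x,y)$, $x=(x^0,\bar x)$, $y=(y^0,\bar y)$, with indices $A,B,C$ running over $0,\dots,n$, and put $\alpha=|\bar y|$, $z=y^0/|\bar y|$, $\rho=|\bar x|$. Let $F=\alpha\sqrt{\phi(z,\rho)}$; more precisely, let $S$ be an open conic subset of the slit tangent bundle $\{y\ne 0\}$ and let $L=F^2$ be a smooth function on $S$, positively homogeneous of degree $2$ in $y$, whose fundamental tensor $g_{AB}=\frac12 L_{y^Ay^B}$ is non-degenerate on $S$ (any signature is allowed; for $S=\{y\neq0\}$ and $(g_{AB})$ positive definite, $F$ is a classical Finsler metric), such that for $\bar y\ne0$ a point $(x,y)$ lies in $S$ if and only if $(z,\rho)$ lies in a given set $D\subset\mathbb R\times[0,\infty)$, and then $L=|\bar y|^2\phi(z,\rho)$. Let $$G^C=\tfrac14 g^{CA}\big(L_{y^Ax^B}y^B-L_{x^A}\big),\qquad K^C_B=2[G^C]_{x^B}-[G^C]_{x^Ay^B}y^A+2G^A[G^C]_{y^Ay^B}-[G^C]_{y^A}[G^A]_{y^B},$$ let $\mathrm{Ric}=K^A_A$,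 and call $F$ Ricci-flat if $\mathrm{Ric}=0$ on $S$. For $\rho>0$ define $$\Omega=2\phi-z\phi_z,\quad \Lambda=2\phi\phi_{zz}-\phi_z^2,\quad U=\frac{2\phi\phi_{z\rho}-\phi_z\phi_\rho}{2\rho\Lambda},\quad V=\frac{\phi_\rho\phi_{zz}-\phi_z\phi_{z\rho}}{2\rho\Lambda},\quad W=\frac{\phi_\rho}{2\rho\,\Omega},$$ $$P=-(2\rho^2W+1)\big(U_z+nV+(n-3)W\big)-2\big(nW+\rho W_\rho-\rho^2W_z(U-zW)\big),$$ $$Q=2U\big(U_{zz}+nV_z+(n-2)W_z\big)-\tfrac1\rho\big(U_{z\rho}+nV_\rho+(n-3)W_\rho\big)+nV(V+2W)+W\big((n-5)W+2zW_z\big)+U_z(2W-U_z).$$ If $n=1$, assume also that $\Omega\ne0$ at all $(z,\rho)\in D$ with $\rho>0$. (For $n\ge2$ non-degeneracy of $(g_{AB})$ implies this; $\Lambda\ne0$ is always implied.) Then, at all points of $S$ with $\bar x\ne0$ and $\bar y\neq0$, $$\mathrm{Ric}=P(z,\rho)\,|\bar y|^2+Q(z,\rho)\,\langle\bar x,\bar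 y\rangle^2 .$$ If $n\ge2$, then $F$ is Ricci-flat if and only if $P(z,\rho)=Q(z,\rho)=0$ for all $(z,\rho)\in D$ with $\rho>0$. If $n=1$, then $F$ is Ricci-flat if and only if the weaker condition $P(z,\rho)+\rho^2Q(z,\rho)=0$ holds for all $(z,\rho)\in D$ with $\rho>0$. -/

import Mathlib

open scoped ContDiff

namespace WarpedFinsler

noncomputable section

/-- The tangent bundle of `ℝ × ℝⁿ`, as pairs `(x, y)` with `x = (x⁰, x̄)`, `y = (y⁰, ȳ)`.
Coordinates are indexed by `Fin (n + 1)`; index `0` is the factor `ℝ`, and the indices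
`i.succ`, `i : Fin n`, are those of the factor `ℝⁿ`. -/
abbrev TB (n : ℕ) : Type := (Fin (n + 1) → ℝ) × (Fin (n + 1) → ℝ)

/-- The Euclidean inner product `⟨x̄, ȳ⟩` of the `ℝⁿ` parts. -/
def barInner {n : ℕ} (x y : Fin (n + 1) → ℝ) : ℝ := ∑ i : Fin n, x i.succ * y i.succ

/-- The Euclidean norm `|x̄|` of the `ℝⁿ` part. -/
def barNorm {n : ℕ} (x : Fin (n + 1) → ℝ) : ℝ := Real.sqrt (barInner x x)

/-- The variable `z = y⁰ / |ȳ|`. -/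
def zVar {n : ℕ} (v : TB n) : ℝ := v.2 0 / barNorm v.2

/-- The variable `ρ = |x̄|`. -/
def rhoVar {n : ℕ} (v : TB n) : ℝ := barNorm v.1

/-! ### Finsler geometry in the coordinates `(x, y)` -/

/-- The partial derivative `∂f / ∂x^A` of a function on the tangent bundle. -/
def dX {n : ℕ} (a : Fin (n + 1)) (f : TB n → ℝ) (v : TB n) : ℝ :=
  fderiv ℝ f v (Pi.single a 1, 0)

/-- The partial derivative `∂f / ∂y^A` of a function on the tangent bundle. -/
def dY {n : ℕ} (a : Fin (n + 1)) (f : TB n → ℝ) (v : TB n) : ℝ :=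
  fderiv ℝ f v (0, Pi.single a 1)

/-- The fundamental tensor `g_{AB} = ½ [L]_{y^A y^B}` of `L = F²`. -/
def fundTensor {n : ℕ} (L : TB n → ℝ) (v : TB n) : Matrix (Fin (n + 1)) (Fin (n + 1)) ℝ :=
  Matrix.of fun a b => (1 / 2 : ℝ) * dY b (dY a L) v

/-- The spray coefficients `G^C = ¼ g^{CA} ([L]_{y^A x^B} y^B - [L]_{x^A})` of `L = F²`. -/
def spray {n : ℕ} (L : TB n → ℝ) (c : Fin (n + 1)) (v : TB n) : ℝ :=
  (1 / 4 : ℝ) * ∑ a, (fundTensor L v)⁻¹ c a * ((∑ b, dX b (dY a L) v * v.2 b) - dX a L v)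

/-- The flag curvature tensor `K_B^C` by Berwald's formula. -/
def flagCurv {n : ℕ} (L : TB n → ℝ) (b c : Fin (n + 1)) (v : TB n) : ℝ :=
  2 * dX b (spray L c) v - (∑ a, dX a (dY b (spray L c)) v * v.2 a)
    + 2 * (∑ a, spray L a v * dY a (dY b (spray L c)) v)
    - ∑ a, dY a (spray L c) v * dY b (spray L a) v

/-- The Ricci curvature `Ric = K_A^A`. -/
def ricci {n : ℕ} (L : TB n → ℝ) (v : TB n) : ℝ := ∑ a, flagCurv L a a v

/-- `L = F²` is a smooth non-degenerate (pseudo-)Finsler metric of any signature, defined on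
the open cone domain `S` of the slit tangent bundle. A classical Finsler metric is the case
where `S` is the whole slit tangent bundle and the fundamental tensor is positive definite. -/
structure IsPseudoFinsler {n : ℕ} (S : Set (TB n)) (L : TB n → ℝ) : Prop where
  isOpen : IsOpen S
  ne_zero : ∀ v ∈ S, v.2 ≠ 0
  cone : ∀ v ∈ S, ∀ c : ℝ, 0 < c → (v.1, c • v.2) ∈ S
  smooth : ContDiffOn ℝ ∞ L S
  homogeneous : ∀ v ∈ S, ∀ c : ℝ, 0 < c → L (v.1, c • v.2) = c ^ 2 * L v
  nondegenerate : ∀ v ∈ S, (fundTensor L v).det ≠ 0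

/-- `L = F²` with `F = α √φ(z, ρ)`, `α = |ȳ|`, where `φ` is considered on the set `D` of
pairs `(z, ρ)`. Where `ȳ = 0` the variable `z` is undefined, and there (as far as such
points belong to `S`) `L` is the smooth extension. -/
structure IsWarped {n : ℕ} (φ : ℝ → ℝ → ℝ) (D : Set (ℝ × ℝ)) (S : Set (TB n))
    (L : TB n → ℝ) : Prop where
  mem_iff : ∀ v : TB n, 0 < barNorm v.2 → (v ∈ S ↔ (zVar v, rhoVar v) ∈ D)
  eq : ∀ v ∈ S, 0 < barNorm v.2 → L v = barNorm v.2 ^ 2 * φ (zVar v) (rhoVar v)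

/-- Ricci-flatness on the domain `S`: the Ricci curvature vanishes there. -/
def IsRicciFlat {n : ℕ} (S : Set (TB n)) (L : TB n → ℝ) : Prop := ∀ v ∈ S, ricci L v = 0

/-! ### The functions built from `φ(z, ρ)` -/

/-- The partial derivative `f_z` of a function of `(z, ρ)`. -/
def pz (f : ℝ → ℝ → ℝ) (z ρ : ℝ) : ℝ := deriv (fun s => f s ρ) z

/-- The partial derivative `f_ρ` of a function of `(z, ρ)`. -/
def pr (f : ℝ → ℝ → ℝ) (z ρ : ℝ) : ℝ := deriv (fun r => f z r) ρ

/-- `Ω = 2φ - z φ_z`. -/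
def Omega (φ : ℝ → ℝ → ℝ) (z ρ : ℝ) : ℝ := 2 * φ z ρ - z * pz φ z ρ

/-- `Λ = 2 φ φ_zz - φ_z²`. -/
def Lam (φ : ℝ → ℝ → ℝ) (z ρ : ℝ) : ℝ := 2 * φ z ρ * pz (pz φ) z ρ - pz φ z ρ ^ 2

/-- `U = (2 φ φ_zρ - φ_z φ_ρ) / (2 ρ Λ)`. -/
def U (φ : ℝ → ℝ → ℝ) (z ρ : ℝ) : ℝ :=
  (2 * φ z ρ * pr (pz φ) z ρ - pz φ z ρ * pr φ z ρ) / (2 * ρ * Lam φ z ρ)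

/-- `V = (φ_ρ φ_zz - φ_z φ_zρ) / (2 ρ Λ)`. -/
def V (φ : ℝ → ℝ → ℝ) (z ρ : ℝ) : ℝ :=
  (pr φ z ρ * pz (pz φ) z ρ - pz φ z ρ * pr (pz φ) z ρ) / (2 * ρ * Lam φ z ρ)

/-- `W = φ_ρ / (2 ρ Ω)`. -/
def W (φ : ℝ → ℝ → ℝ) (z ρ : ℝ) : ℝ := pr φ z ρ / (2 * ρ * Omega φ z ρ)

/-- The Ricci curvature component `P(z, ρ)`, the coefficient of `|ȳ|²`. -/
def P (n : ℕ) (φ : ℝ → ℝ → ℝ) (z ρ : ℝ) : ℝ :=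
  -(2 * ρ ^ 2 * W φ z ρ + 1) * (pz (U φ) z ρ + n * V φ z ρ + ((n : ℝ) - 3) * W φ z ρ)
    - 2 * (n * W φ z ρ + ρ * pr (W φ) z ρ
        - ρ ^ 2 * pz (W φ) z ρ * (U φ z ρ - z * W φ z ρ))

/-- The Ricci curvature component `Q(z, ρ)`, the coefficient of `⟨x̄, ȳ⟩²`. -/
def Q (n : ℕ) (φ : ℝ → ℝ → ℝ) (z ρ : ℝ) : ℝ :=
  2 * U φ z ρ * (pz (pz (U φ)) z ρ + n * pz (V φ) z ρ + ((n : ℝ) - 2) * pz (W φ) z ρ)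
    - 1 / ρ * (pr (pz (U φ)) z ρ + n * pr (V φ) z ρ + ((n : ℝ) - 3) * pr (W φ) z ρ)
    + n * V φ z ρ * (V φ z ρ + 2 * W φ z ρ)
    + W φ z ρ * (((n : ℝ) - 5) * W φ z ρ + 2 * z * pz (W φ) z ρ)
    + pz (U φ) z ρ * (2 * W φ z ρ - pz (U φ) z ρ)

end

end WarpedFinsler

open WarpedFinsler

/-! Everything is computed where `x̄ ≠ 0` and `ȳ ≠ 0`; there `L` depends only on `|ȳ|`, `z` and `ρ`.
The spray is found by solving `g G = ¼([L]_{yx} y - [L]_x)` with an ansatz: `G⁰` a multiple of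
`|ȳ|⟨x̄,ȳ⟩`, and `Ḡ` a combination of `x̄` and `ȳ`. The system splits into two linear equations for
`U`, `V` with determinant `Λ`, and one for `W` with coefficient `Ω`. Non-degeneracy of `g` makes the
solution unique (`IsWarped.spray_eq`), so `g⁻¹` is never computed explicitly. It also gives `Λ ≠ 0`,
and `Ω ≠ 0` when `n ≥ 2`.

In the trace of Berwald's formula, second derivatives of the spray occur only through directional
derivatives of the divergence `∑ ∂G^c/∂y^c` (`IsPseudoFinsler.ricci_eq`). The spatial block of
`∂G/∂y` is a scalar matrix plus terms built from `x̄` and `ȳ`, so all traces reduce to `|x̄|²`,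
`|ȳ|²` and `⟨x̄,ȳ⟩` (`trace_sq_scalar_add_rank_two`). Collecting terms gives `P` and `Q`.

For Ricci-flatness, regular points are dense in `S` and `Ric` is continuous, so vanishing there
suffices. If `n ≥ 2`, orthogonal and parallel pairs `x̄, ȳ` with the same `(z, ρ)` separate `P` from
`Q`; if `n = 1`, only parallel pairs exist. -/

namespace WarpedFinsler

/-! ### Directional derivatives -/

/-- `f` is differentiable at `v`, with derivative `d` in the direction `w`. -/
def HasDirDeriv {E : Type*} [NormedAddCommGroup E] [NormedSpace ℝ E]
    (f : E → ℝ) (v w : E) (d : ℝ) : Prop :=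
  DifferentiableAt ℝ f v ∧ fderiv ℝ f v w = d

namespace HasDirDeriv

variable {E : Type*} [NormedAddCommGroup E] [NormedSpace ℝ E] {f g : E → ℝ} {v w : E} {a b : ℝ}

theorem congr_deriv (hf : HasDirDeriv f v w a) (h : a = b) : HasDirDeriv f v w b := h ▸ hf

theorem add (hf : HasDirDeriv f v w a) (hg : HasDirDeriv g v w b) :
    HasDirDeriv (fun u => f u + g u) v w (a + b) :=
  ⟨hf.1.add hg.1, by
    rw [(hf.1.hasFDerivAt.fun_add hg.1.hasFDerivAt).fderiv]; simp [hf.2, hg.2]⟩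

theorem sub (hf : HasDirDeriv f v w a) (hg : HasDirDeriv g v w b) :
    HasDirDeriv (fun u => f u - g u) v w (a - b) :=
  ⟨hf.1.sub hg.1, by
    rw [(hf.1.hasFDerivAt.fun_sub hg.1.hasFDerivAt).fderiv]; simp [hf.2, hg.2]⟩

theorem mul (hf : HasDirDeriv f v w a) (hg : HasDirDeriv g v w b) :
    HasDirDeriv (fun u => f u * g u) v w (a * g v + f v * b) :=
  ⟨hf.1.mul hg.1, by
    rw [(hf.1.hasFDerivAt.fun_mul hg.1.hasFDerivAt).fderiv]; simp [hf.2, hg.2]; ring⟩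

theorem pow_two (hf : HasDirDeriv f v w a) :
    HasDirDeriv (fun u => f u ^ 2) v w (2 * f v * a) := by
  simp only [sq]
  exact (hf.mul hf).congr_deriv (by ring)

theorem div (hf : HasDirDeriv f v w a) (hg : HasDirDeriv g v w b) (h : g v ≠ 0) :
    HasDirDeriv (fun u => f u / g u) v w ((a * g v - f v * b) / g v ^ 2) := by
  have key := hf.1.hasFDerivAt.fun_mul ((hasDerivAt_inv h).comp_hasFDerivAt v hg.1.hasFDerivAt)
  simp only [div_eq_mul_inv]
  refine ⟨key.differentiableAt, ?_⟩
  have e : fderiv ℝ (fun u => f u * (g u)⁻¹) v = _ := key.fderiv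
  rw [e]
  simp [hf.2, hg.2]
  field_simp
  ring

theorem sqrt (hf : HasDirDeriv f v w a) (h : f v ≠ 0) :
    HasDirDeriv (fun u => Real.sqrt (f u)) v w (a / (2 * Real.sqrt (f v))) :=
  ⟨hf.1.sqrt h, by
    rw [(hf.1.hasFDerivAt.sqrt h).fderiv]; simp [hf.2]; ring⟩

theorem const (c : ℝ) : HasDirDeriv (fun _ : E => c) v w 0 :=
  ⟨differentiableAt_const c, by simp⟩

theorem sum {ι : Type*} {s : Finset ι} {f : ι → E → ℝ} {a : ι → ℝ}
    (hf : ∀ i ∈ s, HasDirDeriv (f i) v w (a i)) :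
    HasDirDeriv (fun u => ∑ i ∈ s, f i u) v w (∑ i ∈ s, a i) :=
  ⟨DifferentiableAt.fun_sum fun i hi => (hf i hi).1, by
    rw [fderiv_fun_sum fun i hi => (hf i hi).1]
    simp only [sum_apply]
    exact Finset.sum_congr rfl fun i hi => (hf i hi).2⟩

theorem congr_of_eventuallyEq (hf : HasDirDeriv f v w a) (h : g =ᶠ[nhds v] f) :
    HasDirDeriv g v w a :=
  ⟨hf.1.congr_of_eventuallyEq h, by rw [h.fderiv_eq, hf.2]⟩

end HasDirDeriv

/-! ### Smooth functions of two real variables -/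

/-- `f` is smooth on `E` as a function of two variables. -/
def SmoothOn₂ (f : ℝ → ℝ → ℝ) (E : Set (ℝ × ℝ)) : Prop :=
  ContDiffOn ℝ ∞ (fun p : ℝ × ℝ => f p.1 p.2) E

section TwoVariables

variable {f : ℝ → ℝ → ℝ} {E : Set (ℝ × ℝ)} {p : ℝ × ℝ}

theorem SmoothOn₂.differentiableAt (hf : SmoothOn₂ f E) (hE : IsOpen E) (hp : p ∈ E) :
    DifferentiableAt ℝ (fun p : ℝ × ℝ => f p.1 p.2) p :=
  (hf.contDiffAt (hE.mem_nhds hp)).differentiableAt (by simp)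

theorem pz_eq_fderiv (hf : DifferentiableAt ℝ (fun p : ℝ × ℝ => f p.1 p.2) p) :
    pz f p.1 p.2 = fderiv ℝ (fun p : ℝ × ℝ => f p.1 p.2) p (1, 0) := by
  have h : HasDerivAt (fun s : ℝ => (s, p.2)) (1, 0) p.1 :=
    (hasDerivAt_id p.1).prodMk (hasDerivAt_const p.1 p.2)
  exact (hf.hasFDerivAt.comp_hasDerivAt p.1 h).deriv

theorem pr_eq_fderiv (hf : DifferentiableAt ℝ (fun p : ℝ × ℝ => f p.1 p.2) p) :
    pr f p.1 p.2 = fderiv ℝ (fun p : ℝ × ℝ => f p.1 p.2) p (0, 1) := by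
  have h : HasDerivAt (fun s : ℝ => (p.1, s)) (0, 1) p.2 :=
    (hasDerivAt_const p.2 p.1).prodMk (hasDerivAt_id p.2)
  exact (hf.hasFDerivAt.comp_hasDerivAt p.2 h).deriv

theorem SmoothOn₂.pz (hf : SmoothOn₂ f E) (hE : IsOpen E) : SmoothOn₂ (pz f) E :=
  ((hf.fderiv_of_isOpen hE (m := ∞) (by simp)).clm_apply contDiffOn_const).congr
    fun _ hp => pz_eq_fderiv (hf.differentiableAt hE hp)

theorem SmoothOn₂.pr (hf : SmoothOn₂ f E) (hE : IsOpen E) : SmoothOn₂ (pr f) E :=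
  ((hf.fderiv_of_isOpen hE (m := ∞) (by simp)).clm_apply contDiffOn_const).congr
    fun _ hp => pr_eq_fderiv (hf.differentiableAt hE hp)

theorem HasDirDeriv.comp₂ {X : Type*} [NormedAddCommGroup X] [NormedSpace ℝ X]
    {g h : X → ℝ} {v w : X} {a b : ℝ}
    (hf : DifferentiableAt ℝ (fun p : ℝ × ℝ => f p.1 p.2) (g v, h v))
    (hg : HasDirDeriv g v w a) (hh : HasDirDeriv h v w b) :
    HasDirDeriv (fun u => f (g u) (h u)) v w
      (WarpedFinsler.pz f (g v) (h v) * a + WarpedFinsler.pr f (g v) (h v) * b) := by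
  have key := hf.hasFDerivAt.comp v (hg.1.hasFDerivAt.prodMk hh.1.hasFDerivAt)
  refine ⟨key.differentiableAt, ?_⟩
  have e : fderiv ℝ (fun u => f (g u) (h u)) v = _ := key.fderiv
  have hab : ((a, b) : ℝ × ℝ) = a • (1, 0) + b • (0, 1) := by simp
  rw [e]
  have e1 := pz_eq_fderiv hf
  have e2 := pr_eq_fderiv hf
  simp only at e1 e2
  rw [e1, e2]
  simp only [ContinuousLinearMap.comp_apply, ContinuousLinearMap.prod_apply, hg.2, hh.2]
  rw [hab, map_add, map_smul, map_smul]
  simp [mul_comm]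

end TwoVariables

/-! ### The basic functions on the tangent bundle -/

section Basic

variable {n : ℕ}

theorem barInner_comm (x y : Fin (n + 1) → ℝ) : barInner x y = barInner y x :=
  Finset.sum_congr rfl fun _ _ => mul_comm _ _

theorem barInner_add_smul_right (x y w : Fin (n + 1) → ℝ) (a b : ℝ) :
    barInner x (a • y + b • w) = a * barInner x y + b * barInner x w := by
  simp only [barInner, Pi.add_apply, Pi.smul_apply, smul_eq_mul, Finset.mul_sum,
    ← Finset.sum_add_distrib]
  exact Finset.sum_congr rfl fun _ _ => by ring

theorem barInner_self_nonneg (x : Fin (n + 1) → ℝ) : 0 ≤ barInner x x :=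
  Finset.sum_nonneg fun _ _ => mul_self_nonneg _

theorem barNorm_sq (x : Fin (n + 1) → ℝ) : barNorm x ^ 2 = barInner x x :=
  Real.sq_sqrt (barInner_self_nonneg x)

theorem barNorm_pos_iff {x : Fin (n + 1) → ℝ} : 0 < barNorm x ↔ ∃ i : Fin n, x i.succ ≠ 0 := by
  rw [barNorm, Real.sqrt_pos, barInner]
  constructor
  · intro h
    by_contra! hx
    simp [hx] at h
  · rintro ⟨i, hi⟩
    exact Finset.sum_pos' (fun _ _ => mul_self_nonneg _)
      ⟨i, Finset.mem_univ i, mul_self_pos.mpr hi⟩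

@[simp] theorem barInner_zero_right (x : Fin (n + 1) → ℝ) : barInner x 0 = 0 := by
  simp [barInner]

@[simp] theorem barInner_single_zero (x : Fin (n + 1) → ℝ) (c : ℝ) :
    barInner x (Pi.single 0 c) = 0 := by
  simp [barInner, Fin.succ_ne_zero]

@[simp] theorem barInner_single_succ (x : Fin (n + 1) → ℝ) (i : Fin n) (c : ℝ) :
    barInner x (Pi.single i.succ c) = x i.succ * c := by
  simp [barInner, Pi.single_apply]

@[fun_prop]
theorem continuous_barNorm : Continuous (barNorm : (Fin (n + 1) → ℝ) → ℝ) := by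
  unfold barNorm barInner
  fun_prop

variable (v w : TB n)

theorem hasDirDeriv_fst_apply (a : Fin (n + 1)) :
    HasDirDeriv (fun u : TB n => u.1 a) v w (w.1 a) := by
  have h := ((ContinuousLinearMap.proj (R := ℝ) (φ := fun _ : Fin (n + 1) => ℝ) a).comp
    (ContinuousLinearMap.fst ℝ (Fin (n + 1) → ℝ) (Fin (n + 1) → ℝ))).hasFDerivAt (x := v)
  exact ⟨h.differentiableAt, congrArg (· w) h.fderiv⟩

theorem hasDirDeriv_snd_apply (a : Fin (n + 1)) :
    HasDirDeriv (fun u : TB n => u.2 a) v w (w.2 a) := by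
  have h := ((ContinuousLinearMap.proj (R := ℝ) (φ := fun _ : Fin (n + 1) => ℝ) a).comp
    (ContinuousLinearMap.snd ℝ (Fin (n + 1) → ℝ) (Fin (n + 1) → ℝ))).hasFDerivAt (x := v)
  exact ⟨h.differentiableAt, congrArg (· w) h.fderiv⟩

theorem hasDirDeriv_barInner :
    HasDirDeriv (fun u : TB n => barInner u.1 u.2) v w
      (barInner v.2 w.1 + barInner v.1 w.2) := by
  refine (HasDirDeriv.sum (s := Finset.univ) fun (i : Fin n) _ =>
    (hasDirDeriv_fst_apply v w i.succ).mul (hasDirDeriv_snd_apply v w i.succ)).congr_deriv ?_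
  simp [barInner, Finset.sum_add_distrib, mul_comm]

variable {v}

theorem hasDirDeriv_rhoVar (h : 0 < barNorm v.1) :
    HasDirDeriv rhoVar v w (barInner v.1 w.1 / rhoVar v) := by
  have h1 : HasDirDeriv (fun u : TB n => barInner u.1 u.1) v w (2 * barInner v.1 w.1) := by
    refine (HasDirDeriv.sum (s := Finset.univ) fun (i : Fin n) _ =>
      (hasDirDeriv_fst_apply v w i.succ).mul (hasDirDeriv_fst_apply v w i.succ)).congr_deriv ?_
    simp only [barInner, Finset.mul_sum]
    exact Finset.sum_congr rfl fun _ _ => by ring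
  refine (h1.sqrt (Real.sqrt_pos.mp h).ne').congr_deriv ?_
  change _ = _ / Real.sqrt _
  rw [mul_div_mul_left _ _ two_ne_zero]

theorem hasDirDeriv_barNorm_snd (h : 0 < barNorm v.2) :
    HasDirDeriv (fun u : TB n => barNorm u.2) v w (barInner v.2 w.2 / barNorm v.2) := by
  have h1 : HasDirDeriv (fun u : TB n => barInner u.2 u.2) v w (2 * barInner v.2 w.2) := by
    refine (HasDirDeriv.sum (s := Finset.univ) fun (i : Fin n) _ =>
      (hasDirDeriv_snd_apply v w i.succ).mul (hasDirDeriv_snd_apply v w i.succ)).congr_deriv ?_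
    simp only [barInner, Finset.mul_sum]
    exact Finset.sum_congr rfl fun _ _ => by ring
  refine (h1.sqrt (Real.sqrt_pos.mp h).ne').congr_deriv ?_
  change _ = _ / Real.sqrt _
  rw [mul_div_mul_left _ _ two_ne_zero]

theorem hasDirDeriv_zVar (h : 0 < barNorm v.2) :
    HasDirDeriv zVar v w
      (w.2 0 / barNorm v.2 - zVar v * barInner v.2 w.2 / barNorm v.2 ^ 2) := by
  refine ((hasDirDeriv_snd_apply v w 0).div (hasDirDeriv_barNorm_snd w h) h.ne').congr_deriv ?_
  rw [zVar]
  field_simp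

theorem hasDirDeriv_comp_zVar_rhoVar {f : ℝ → ℝ → ℝ} {E : Set (ℝ × ℝ)} (hf : SmoothOn₂ f E)
    (hE : IsOpen E) (hv : (zVar v, rhoVar v) ∈ E) (h₁ : 0 < barNorm v.1) (h₂ : 0 < barNorm v.2) :
    HasDirDeriv (fun u : TB n => f (zVar u) (rhoVar u)) v w
      (pz f (zVar v) (rhoVar v) *
          (w.2 0 / barNorm v.2 - zVar v * barInner v.2 w.2 / barNorm v.2 ^ 2)
        + pr f (zVar v) (rhoVar v) * (barInner v.1 w.1 / rhoVar v)) :=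
  HasDirDeriv.comp₂ (hf.differentiableAt hE hv) (hasDirDeriv_zVar w h₂) (hasDirDeriv_rhoVar w h₁)

end Basic

/-! ### Smoothness and the directional form of coordinate sums -/

section Smooth

variable {n : ℕ} {S : Set (TB n)} {f L : TB n → ℝ}

theorem contDiffOn_dX (hS : IsOpen S) (hf : ContDiffOn ℝ ∞ f S) (a : Fin (n + 1)) :
    ContDiffOn ℝ ∞ (dX a f) S :=
  (hf.fderiv_of_isOpen hS (m := ∞) (by simp)).clm_apply contDiffOn_const

theorem contDiffOn_dY (hS : IsOpen S) (hf : ContDiffOn ℝ ∞ f S) (a : Fin (n + 1)) :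
    ContDiffOn ℝ ∞ (dY a f) S :=
  (hf.fderiv_of_isOpen hS (m := ∞) (by simp)).clm_apply contDiffOn_const

theorem sum_dX_mul (v : TB n) (c : Fin (n + 1) → ℝ) :
    ∑ a, dX a f v * c a = fderiv ℝ f v (c, 0) := by
  have : ((c, 0) : TB n) = ∑ a, c a • ((Pi.single a 1, 0) : TB n) := by
    ext i <;> simp [Prod.fst_sum, Prod.snd_sum, Finset.sum_apply, Pi.single_apply]
  rw [this, map_sum]
  exact Finset.sum_congr rfl fun a _ => by rw [map_smul, smul_eq_mul, mul_comm]; rfl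

theorem sum_dY_mul (v : TB n) (c : Fin (n + 1) → ℝ) :
    ∑ a, dY a f v * c a = fderiv ℝ f v (0, c) := by
  have : ((0, c) : TB n) = ∑ a, c a • ((0, Pi.single a 1) : TB n) := by
    ext i <;> simp [Prod.fst_sum, Prod.snd_sum, Finset.sum_apply, Pi.single_apply]
  rw [this, map_sum]
  exact Finset.sum_congr rfl fun a _ => by rw [map_smul, smul_eq_mul, mul_comm]; rfl

theorem contDiffOn_snd_apply (a : Fin (n + 1)) : ContDiffOn ℝ ∞ (fun v : TB n => v.2 a) S := by
  fun_prop

theorem IsPseudoFinsler.contDiffOn_fundTensor (hL : IsPseudoFinsler S L) (a b : Fin (n + 1)) :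
    ContDiffOn ℝ ∞ (fun v => fundTensor L v a b) S :=
  contDiffOn_const.mul (contDiffOn_dY hL.isOpen (contDiffOn_dY hL.isOpen hL.smooth a) b)

theorem contDiffOn_det {ι : Type*} [Fintype ι] [DecidableEq ι] {M : TB n → Matrix ι ι ℝ}
    (hM : ∀ i j, ContDiffOn ℝ ∞ (fun v => M v i j) S) :
    ContDiffOn ℝ ∞ (fun v => (M v).det) S := by
  simp only [Matrix.det_apply]
  exact ContDiffOn.sum fun σ _ => (contDiffOn_prod fun i _ => hM _ _).const_smul _

/-- Cramer's rule: each entry is a cofactor divided by a determinant that does not vanish on `S`. -/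
theorem IsPseudoFinsler.contDiffOn_inv (hL : IsPseudoFinsler S L) (a b : Fin (n + 1)) :
    ContDiffOn ℝ ∞ (fun v => (fundTensor L v)⁻¹ a b) S := by
  simp only [Matrix.inv_def, Matrix.smul_apply, Ring.inverse_eq_inv', smul_eq_mul,
    Matrix.adjugate_apply]
  refine ((contDiffOn_det hL.contDiffOn_fundTensor).inv hL.nondegenerate).mul
    (contDiffOn_det fun i j => ?_)
  -- Row `b` has been replaced by a constant unit vector; the other rows are those of `fundTensor L
  -- v`.
  by_cases h : i = b
  · subst h
    simpa using contDiffOn_const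
  · simpa [Matrix.updateRow_ne h] using hL.contDiffOn_fundTensor i j

theorem IsPseudoFinsler.contDiffOn_spray (hL : IsPseudoFinsler S L) (c : Fin (n + 1)) :
    ContDiffOn ℝ ∞ (spray L c) S := by
  have hS := hL.isOpen
  unfold spray
  exact contDiffOn_const.mul (ContDiffOn.sum fun a _ => (hL.contDiffOn_inv c a).mul
    ((ContDiffOn.sum fun b _ => (contDiffOn_dX hS (contDiffOn_dY hS hL.smooth a) b).mul
      (contDiffOn_snd_apply b)).sub (contDiffOn_dX hS hL.smooth a)))

theorem IsPseudoFinsler.contDiffOn_ricci (hL : IsPseudoFinsler S L) :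
    ContDiffOn ℝ ∞ (ricci L) S := by
  have hS := hL.isOpen
  have hG := hL.contDiffOn_spray
  unfold ricci flagCurv
  exact ContDiffOn.sum fun c _ => (((contDiffOn_const.mul (contDiffOn_dX hS (hG c) c)).sub
    (ContDiffOn.sum fun a _ => (contDiffOn_dX hS (contDiffOn_dY hS (hG c) c) a).mul
      (contDiffOn_snd_apply a))).add
    (contDiffOn_const.mul (ContDiffOn.sum fun a _ => (hG a).mul
      (contDiffOn_dY hS (contDiffOn_dY hS (hG c) c) a)))).sub
    (ContDiffOn.sum fun a _ => (contDiffOn_dY hS (hG c) a).mul (contDiffOn_dY hS (hG a) c))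

end Smooth

/-! ### Regular points -/

/-- The points of `S` with `x̄ ≠ 0` and `ȳ ≠ 0`. -/
def regularSet {n : ℕ} (S : Set (TB n)) : Set (TB n) :=
  {v | v ∈ S ∧ 0 < barNorm v.1 ∧ 0 < barNorm v.2}

/-- The pairs `(z, ρ)` in `D` with `ρ > 0`. -/
def regularDomain (D : Set (ℝ × ℝ)) : Set (ℝ × ℝ) := {p | p ∈ D ∧ 0 < p.2}

section Points

variable {n : ℕ} {φ : ℝ → ℝ → ℝ} {D : Set (ℝ × ℝ)} {S : Set (TB n)} {L : TB n → ℝ}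

theorem isOpen_regularSet (hS : IsOpen S) : IsOpen (regularSet S) :=
  hS.inter ((isOpen_lt continuous_const (continuous_barNorm.comp continuous_fst)).inter
    (isOpen_lt continuous_const (continuous_barNorm.comp continuous_snd)))

theorem IsWarped.mem_regularDomain (hφ : IsWarped φ D S L) {v : TB n} (hv : v ∈ regularSet S) :
    (zVar v, rhoVar v) ∈ regularDomain D :=
  ⟨(hφ.mem_iff v hv.2.2).1 hv.1, hv.2.1⟩

/-- The point with `x̄ = ρ e_j`, `ȳ = e_i` and `y⁰ = z`. -/
noncomputable def testPoint (i j : Fin n) (p : ℝ × ℝ) : TB n :=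
  (p.2 • Pi.single j.succ 1, p.1 • Pi.single 0 1 + (1 : ℝ) • Pi.single i.succ 1)

variable (i j : Fin n) (p : ℝ × ℝ)

theorem contDiff_testPoint : ContDiff ℝ ∞ (testPoint i j) := by
  unfold testPoint
  exact (contDiff_snd.smul contDiff_const).prodMk
    ((contDiff_fst.smul contDiff_const).add contDiff_const)

theorem barNorm_testPoint_snd : barNorm (testPoint i j p).2 = 1 := by
  rw [barNorm, Real.sqrt_eq_one]
  simp only [testPoint, barInner_add_smul_right, barInner_single_zero, barInner_single_succ]
  simp [Fin.succ_ne_zero]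

theorem barNorm_testPoint_fst {p : ℝ × ℝ} (hp : 0 < p.2) : barNorm (testPoint i j p).1 = p.2 := by
  have h := barInner_add_smul_right (testPoint i j p).1 (Pi.single j.succ 1) 0 p.2 0
  rw [barNorm, ← Real.sqrt_mul_self hp.le]
  congr 1
  rw [smul_zero, add_zero] at h
  exact h.trans (by simp [testPoint])

theorem zVar_testPoint : zVar (testPoint i j p) = p.1 := by
  rw [zVar, barNorm_testPoint_snd]
  simp [testPoint, (Fin.succ_ne_zero i).symm]

theorem rhoVar_testPoint {p : ℝ × ℝ} (hp : 0 < p.2) : rhoVar (testPoint i j p) = p.2 :=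
  barNorm_testPoint_fst i j hp

theorem barInner_testPoint :
    barInner (testPoint i j p).1 (testPoint i j p).2 = if i = j then p.2 else 0 := by
  simp only [testPoint, barInner_add_smul_right, barInner_single_zero, barInner_single_succ]
  simp [Pi.single_apply]

variable {i j p}

theorem IsWarped.testPoint_mem_iff (hφ : IsWarped φ D S L) (hp : 0 < p.2) :
    testPoint i j p ∈ S ↔ p ∈ D := by
  rw [hφ.mem_iff _ (by simp [barNorm_testPoint_snd]), zVar_testPoint, rhoVar_testPoint i j hp]

theorem IsWarped.testPoint_mem_regularSet (hφ : IsWarped φ D S L) (hp : p ∈ regularDomain D) :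
    testPoint i j p ∈ regularSet S :=
  ⟨(hφ.testPoint_mem_iff hp.2).2 hp.1, by rw [barNorm_testPoint_fst i j hp.2]; exact hp.2,
    by simp [barNorm_testPoint_snd]⟩

/-- `D` is not assumed open; openness is pulled back from `S` along the continuous map `testPoint i
i`. -/
theorem IsWarped.isOpen_regularDomain (hφ : IsWarped φ D S L) (hS : IsOpen S) (i : Fin n) :
    IsOpen (regularDomain D) := by
  have : regularDomain D = testPoint i i ⁻¹' S ∩ {p | 0 < p.2} := by
    ext p
    constructor
    · exact fun h => ⟨(hφ.testPoint_mem_iff h.2).2 h.1, h.2⟩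
    · exact fun h => ⟨(hφ.testPoint_mem_iff h.2).1 h.1, h.2⟩
  rw [this]
  exact (hS.preimage (contDiff_testPoint i i).continuous).inter
    (isOpen_lt continuous_const continuous_snd)

/-- Since `|ȳ| = 1` at test points, `φ` is the restriction of `L` along `testPoint`, and so inherits
its smoothness. -/
theorem IsWarped.smoothOn₂ (hφ : IsWarped φ D S L) (hL : ContDiffOn ℝ ∞ L S) (i : Fin n) :
    SmoothOn₂ φ (regularDomain D) := by
  refine (hL.comp (contDiff_testPoint i i).contDiffOn
    fun p hp => (hφ.testPoint_mem_iff hp.2).2 hp.1).congr fun p hp => ?_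
  rw [Function.comp_apply, hφ.eq _ ((hφ.testPoint_mem_iff hp.2).2 hp.1)
    (by simp [barNorm_testPoint_snd]), zVar_testPoint, rhoVar_testPoint i i hp.2,
    barNorm_testPoint_snd, one_pow, one_mul]

/-- Moving `x̄` and `ȳ` simultaneously by `t e_i` makes both `i`-th components nonzero for all small
`t ≠ 0`. -/
theorem regularSet_dense (hS : IsOpen S) (i : Fin n) : S ⊆ closure (regularSet S) := by
  intro v hv
  have hlim : Filter.Tendsto (fun t : ℝ => v + t • ((Pi.single i.succ 1, Pi.single i.succ 1) : TB n))
      (nhdsWithin 0 {0}ᶜ) (nhds v) := by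
    have : Continuous fun t : ℝ => v + t • ((Pi.single i.succ 1, Pi.single i.succ 1) : TB n) := by
      fun_prop
    simpa using this.continuousAt.tendsto.mono_left (nhdsWithin_le_nhds (a := (0 : ℝ)))
  refine mem_closure_of_tendsto hlim ?_
  have hne : ∀ c : ℝ, ∀ᶠ t : ℝ in nhdsWithin 0 {0}ᶜ, c + t ≠ 0 := by
    intro c
    by_cases hc : c = 0
    · simpa [hc] using eventually_mem_nhdsWithin (a := (0 : ℝ)) (s := {0}ᶜ)
    · refine nhdsWithin_le_nhds (ContinuousAt.eventually_ne (g := fun t => c + t) ?_ ?_)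
      · fun_prop
      · simpa using hc
  filter_upwards [hlim (hS.mem_nhds hv), hne (v.1 i.succ), hne (v.2 i.succ)] with t h1 h2 h3
  exact ⟨h1, barNorm_pos_iff.2 ⟨i, by simpa using h2⟩, barNorm_pos_iff.2 ⟨i, by simpa using h3⟩⟩

end Points

/-! ### Derivatives of `L` -/

section Lagrangian

variable {n : ℕ} {φ : ℝ → ℝ → ℝ} {D : Set (ℝ × ℝ)} {S : Set (TB n)} {L : TB n → ℝ} {v : TB n}

/-- As the regular set is open, a formula valid on it may be differentiated again. -/
theorem HasDirDeriv.congr_on_regularSet {f g : TB n → ℝ} {w : TB n} {d : ℝ}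
    (h : HasDirDeriv f v w d) (hS : IsOpen S) (hv : v ∈ regularSet S)
    (hfg : ∀ u ∈ regularSet S, g u = f u) : HasDirDeriv g v w d :=
  h.congr_of_eventuallyEq
    (Filter.eventuallyEq_of_mem ((isOpen_regularSet hS).mem_nhds hv) hfg)

theorem exists_index (hv : v ∈ regularSet S) : Nonempty (Fin n) :=
  let ⟨i, _⟩ := barNorm_pos_iff.1 hv.2.2
  ⟨i⟩

theorem IsWarped.isOpen_of_mem (hφ : IsWarped φ D S L) (hL : IsPseudoFinsler S L)
    (hv : v ∈ regularSet S) : IsOpen (regularDomain D) :=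
  let ⟨i⟩ := exists_index hv
  hφ.isOpen_regularDomain hL.isOpen i

theorem IsWarped.smooth_of_mem (hφ : IsWarped φ D S L) (hL : IsPseudoFinsler S L)
    (hv : v ∈ regularSet S) : SmoothOn₂ φ (regularDomain D) :=
  let ⟨i⟩ := exists_index hv
  hφ.smoothOn₂ hL.smooth i

theorem IsWarped.hasDirDeriv (hφ : IsWarped φ D S L) (hL : IsPseudoFinsler S L)
    {f : ℝ → ℝ → ℝ} (hf : SmoothOn₂ f (regularDomain D)) (hv : v ∈ regularSet S) (w : TB n) :
    HasDirDeriv (fun u : TB n => f (zVar u) (rhoVar u)) v w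
      (pz f (zVar v) (rhoVar v) *
          (w.2 0 / barNorm v.2 - zVar v * barInner v.2 w.2 / barNorm v.2 ^ 2)
        + pr f (zVar v) (rhoVar v) * (barInner v.1 w.1 / rhoVar v)) :=
  hasDirDeriv_comp_zVar_rhoVar w hf (hφ.isOpen_of_mem hL hv) (hφ.mem_regularDomain hv)
    hv.2.1 hv.2.2

/-- `Ω` arises here: differentiating `|ȳ|²` contributes `2φ`, and differentiating `z` contributes
`-zφ_z`. -/
theorem IsWarped.hasDirDeriv_lagrangian (hφ : IsWarped φ D S L) (hL : IsPseudoFinsler S L)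
    (hv : v ∈ regularSet S) (w : TB n) :
    HasDirDeriv L v w (barNorm v.2 * pz φ (zVar v) (rhoVar v) * w.2 0
      + Omega φ (zVar v) (rhoVar v) * barInner v.2 w.2
      + barNorm v.2 ^ 2 * pr φ (zVar v) (rhoVar v) * (barInner v.1 w.1 / rhoVar v)) := by
  have hα := hv.2.2.ne'
  refine ((((hasDirDeriv_barNorm_snd w hv.2.2).pow_two).mul
    (hφ.hasDirDeriv hL (hφ.smooth_of_mem hL hv) hv w)).congr_on_regularSet hL.isOpen hv
      fun u hu => hφ.eq u hu.1 hu.2.2).congr_deriv ?_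
  rw [Omega]
  field_simp
  ring

theorem IsWarped.dX_zero (hφ : IsWarped φ D S L) (hL : IsPseudoFinsler S L)
    (hv : v ∈ regularSet S) : dX 0 L v = 0 := by
  rw [dX, (hφ.hasDirDeriv_lagrangian hL hv _).2]
  simp

theorem IsWarped.dX_succ (hφ : IsWarped φ D S L) (hL : IsPseudoFinsler S L)
    (hv : v ∈ regularSet S) (i : Fin n) :
    dX i.succ L v = barNorm v.2 ^ 2 * pr φ (zVar v) (rhoVar v) * (v.1 i.succ / rhoVar v) := by
  rw [dX, (hφ.hasDirDeriv_lagrangian hL hv _).2]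
  simp

theorem IsWarped.dY_zero (hφ : IsWarped φ D S L) (hL : IsPseudoFinsler S L)
    (hv : v ∈ regularSet S) : dY 0 L v = barNorm v.2 * pz φ (zVar v) (rhoVar v) := by
  rw [dY, (hφ.hasDirDeriv_lagrangian hL hv _).2]
  simp

theorem IsWarped.dY_succ (hφ : IsWarped φ D S L) (hL : IsPseudoFinsler S L)
    (hv : v ∈ regularSet S) (i : Fin n) :
    dY i.succ L v = Omega φ (zVar v) (rhoVar v) * v.2 i.succ := by
  rw [dY, (hφ.hasDirDeriv_lagrangian hL hv _).2]
  simp [(Fin.succ_ne_zero i).symm]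

theorem IsWarped.hasDirDeriv_dY_zero (hφ : IsWarped φ D S L) (hL : IsPseudoFinsler S L)
    (hv : v ∈ regularSet S) (w : TB n) :
    HasDirDeriv (dY 0 L) v w (pz (pz φ) (zVar v) (rhoVar v) * w.2 0
      + (pz φ (zVar v) (rhoVar v) - zVar v * pz (pz φ) (zVar v) (rhoVar v))
        * (barInner v.2 w.2 / barNorm v.2)
      + barNorm v.2 * pr (pz φ) (zVar v) (rhoVar v) * (barInner v.1 w.1 / rhoVar v)) := by
  have hα := hv.2.2.ne'
  refine (((hasDirDeriv_barNorm_snd w hv.2.2).mul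
    (hφ.hasDirDeriv hL ((hφ.smooth_of_mem hL hv).pz (hφ.isOpen_of_mem hL hv))
      hv w)).congr_on_regularSet hL.isOpen hv fun u hu => hφ.dY_zero hL hu).congr_deriv ?_
  field_simp
  ring

/-- Product rule for `Ω y^i`, with `Ω_z = φ_z - zφ_zz` and `Ω_ρ = 2φ_ρ - zφ_zρ`. -/
theorem IsWarped.hasDirDeriv_dY_succ (hφ : IsWarped φ D S L) (hL : IsPseudoFinsler S L)
    (hv : v ∈ regularSet S) (i : Fin n) (w : TB n) :
    HasDirDeriv (dY i.succ L) v w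
      (((pz φ (zVar v) (rhoVar v) - zVar v * pz (pz φ) (zVar v) (rhoVar v))
          * (w.2 0 / barNorm v.2 - zVar v * barInner v.2 w.2 / barNorm v.2 ^ 2)
        + (2 * pr φ (zVar v) (rhoVar v) - zVar v * pr (pz φ) (zVar v) (rhoVar v))
          * (barInner v.1 w.1 / rhoVar v)) * v.2 i.succ
        + Omega φ (zVar v) (rhoVar v) * w.2 i.succ) := by
  have hs := hφ.smooth_of_mem hL hv
  have hd := ((((HasDirDeriv.const 2).mul (hφ.hasDirDeriv hL hs hv w)).sub
    ((hasDirDeriv_zVar w hv.2.2).mul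
      (hφ.hasDirDeriv hL (hs.pz (hφ.isOpen_of_mem hL hv)) hv w))).mul
      (hasDirDeriv_snd_apply v w i.succ)).congr_on_regularSet hL.isOpen hv
      fun u hu => hφ.dY_succ hL hu i
  refine hd.congr_deriv ?_
  rw [Omega]
  ring

/-! ### Non-degeneracy and the linear system for the spray -/

theorem fundTensor_mulVec (w : Fin (n + 1) → ℝ) (a : Fin (n + 1)) :
    (fundTensor L v).mulVec w a = 1 / 2 * fderiv ℝ (dY a L) v (0, w) := by
  rw [← sum_dY_mul, Finset.mul_sum, Matrix.mulVec, dotProduct]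
  exact Finset.sum_congr rfl fun b _ => by
    simp only [fundTensor, Matrix.of_apply]; ring

theorem IsPseudoFinsler.eq_zero_of_fderiv_eq_zero (hL : IsPseudoFinsler S L) (hv : v ∈ S)
    {w : Fin (n + 1) → ℝ} (h : ∀ a, fderiv ℝ (dY a L) v (0, w) = 0) : w = 0 :=
  Matrix.eq_zero_of_mulVec_eq_zero (hL.nondegenerate v hv)
    (funext fun a => by rw [fundTensor_mulVec, h a]; simp)

/-- Lowering the index removes the inverse matrix: the hypothesis says `g G` equals the right side
of the spray equation, and `g` is invertible. -/
theorem IsPseudoFinsler.spray_eq (hL : IsPseudoFinsler S L) (hv : v ∈ S)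
    {G : Fin (n + 1) → ℝ} (h : ∀ a, 2 * fderiv ℝ (dY a L) v (0, G)
      = fderiv ℝ (dY a L) v (v.2, 0) - dX a L v) (c : Fin (n + 1)) :
    spray L c v = G c := by
  have hG : (fundTensor L v).mulVec G
      = fun a => 1 / 4 * ((∑ b, dX b (dY a L) v * v.2 b) - dX a L v) := by
    ext a
    rw [fundTensor_mulVec, sum_dX_mul, ← h a]
    ring
  have hinv : (fundTensor L v)⁻¹.mulVec ((fundTensor L v).mulVec G) = G := by
    rw [Matrix.mulVec_mulVec,
      Matrix.nonsing_inv_mul _ (isUnit_iff_ne_zero.2 (hL.nondegenerate v hv)), Matrix.one_mulVec]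
  rw [spray, ← congrFun hinv c, hG, Matrix.mulVec, dotProduct, Finset.mul_sum]
  exact Finset.sum_congr rfl fun a _ => by ring

theorem barInner_cons (x : Fin (n + 1) → ℝ) (c : ℝ) (w : Fin n → ℝ) :
    barInner x (Fin.cons c w : Fin (n + 1) → ℝ) = ∑ i, x i.succ * w i := by
  simp [barInner]

/-- On vectors `(p|ȳ|, q ȳ)` the Hessian of `L` acts on `(p, q)` by a symmetric 2×2 matrix of
determinant `Λ`, which must therefore be injective. -/
theorem IsWarped.lam_ne_zero (hφ : IsWarped φ D S L) (hL : IsPseudoFinsler S L)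
    (hv : v ∈ regularSet S) : Lam φ (zVar v) (rhoVar v) ≠ 0 := by
  intro h0
  have hα := hv.2.2.ne'
  obtain ⟨i, hi⟩ := barNorm_pos_iff.1 hv.2.2
  have key : ∀ p q : ℝ,
      pz (pz φ) (zVar v) (rhoVar v) * p + (pz φ (zVar v) (rhoVar v)
        - zVar v * pz (pz φ) (zVar v) (rhoVar v)) * q = 0 →
      (pz φ (zVar v) (rhoVar v) - zVar v * pz (pz φ) (zVar v) (rhoVar v)) * (p - zVar v * q)
        + Omega φ (zVar v) (rhoVar v) * q = 0 → p = 0 ∧ q = 0 := by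
    intro p q h1 h2
    have hy : barInner v.2 (Fin.cons (barNorm v.2 * p) fun i => q * v.2 i.succ :
        Fin (n + 1) → ℝ) = barNorm v.2 ^ 2 * q := by
      rw [barInner_cons, barNorm_sq, barInner, Finset.sum_mul]
      exact Finset.sum_congr rfl fun _ _ => by ring
    have hw := hL.eq_zero_of_fderiv_eq_zero hv.1
      (w := Fin.cons (barNorm v.2 * p) fun i => q * v.2 i.succ) (by
        intro a
        refine Fin.cases ?_ (fun k => ?_) a
        · rw [(hφ.hasDirDeriv_dY_zero hL hv _).2]
          simp only [hy, barInner_zero_right, Fin.cons_zero]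
          field_simp
          linear_combination barNorm v.2 * h1
        · rw [(hφ.hasDirDeriv_dY_succ hL hv k _).2]
          simp only [hy, barInner_zero_right, Fin.cons_zero, Fin.cons_succ]
          field_simp
          linear_combination v.2 k.succ * h2)
    have hw0 := congrFun hw 0
    have hwi := congrFun hw i.succ
    simp only [Fin.cons_zero, Fin.cons_succ, Pi.zero_apply, mul_eq_zero, hα, hi, or_false,
      false_or] at hw0 hwi
    exact ⟨hw0, hwi⟩
  rw [Lam] at h0
  -- This pair annihilates the first row identically and the second because `Λ = 0`. Injectivity
  -- then forces `φ_zz = 0`, hence `φ_z = 0`, after which `(1, 0)` lies in the kernel.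
  have hc := (key (pz φ (zVar v) (rhoVar v) - zVar v * pz (pz φ) (zVar v) (rhoVar v))
    (-pz (pz φ) (zVar v) (rhoVar v)) (by ring) (by rw [Omega]; linear_combination -h0)).2
  have hc' : pz (pz φ) (zVar v) (rhoVar v) = 0 := by linarith
  have hb : pz φ (zVar v) (rhoVar v) = 0 := by
    rw [hc'] at h0
    exact pow_eq_zero_iff two_ne_zero |>.1 (by linarith)
  exact one_ne_zero (key 1 0 (by rw [hc', hb]; ring) (by rw [hc', hb]; ring)).1

/-- A spatial unit vector orthogonal to `ȳ`, available for `n ≥ 2`, is an eigenvector of the Hessian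
of `L` with eigenvalue `Ω`. -/
theorem IsWarped.omega_ne_zero (hφ : IsWarped φ D S L) (hL : IsPseudoFinsler S L) (hn : 2 ≤ n)
    {z ρ : ℝ} (hp : (z, ρ) ∈ regularDomain D) : Omega φ z ρ ≠ 0 := by
  intro h0
  let i : Fin n := ⟨0, by omega⟩
  let j : Fin n := ⟨1, by omega⟩
  have hij : j ≠ i := by simp [i, j]
  have hv := hφ.testPoint_mem_regularSet (i := i) (j := i) hp
  have hz := zVar_testPoint i i (z, ρ)
  have hr := rhoVar_testPoint i i hp.2
  have hy : barInner (testPoint i i (z, ρ)).2 (Pi.single j.succ 1) = 0 := by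
    rw [barInner_single_succ]
    simp [testPoint, Fin.succ_ne_zero, hij]
  have hw := hL.eq_zero_of_fderiv_eq_zero hv.1 (w := Pi.single j.succ 1) (by
    intro a
    refine Fin.cases ?_ (fun k => ?_) a
    · rw [(hφ.hasDirDeriv_dY_zero hL hv _).2]
      simp [hy, (Fin.succ_ne_zero j).symm]
    · rw [(hφ.hasDirDeriv_dY_succ hL hv k _).2]
      simp [hy, (Fin.succ_ne_zero j).symm, hz, hr, h0])
  simpa using congrFun hw j.succ

/-- The spray coefficients of the warped metric. -/
noncomputable def warpedSpray (φ : ℝ → ℝ → ℝ) (v : TB n) : Fin (n + 1) → ℝ :=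
  Fin.cons
    (barNorm v.2 * barInner v.1 v.2
      * (U φ (zVar v) (rhoVar v) + zVar v * V φ (zVar v) (rhoVar v)))
    fun i => barInner v.1 v.2 * (V φ (zVar v) (rhoVar v) + W φ (zVar v) (rhoVar v)) * v.2 i.succ
      - barNorm v.2 ^ 2 * W φ (zVar v) (rhoVar v) * v.1 i.succ

theorem barInner_warpedSpray (x : Fin (n + 1) → ℝ) :
    barInner x (warpedSpray φ v)
      = barInner v.1 v.2 * (V φ (zVar v) (rhoVar v) + W φ (zVar v) (rhoVar v)) * barInner x v.2
        - barNorm v.2 ^ 2 * W φ (zVar v) (rhoVar v) * barInner x v.1 := by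
  rw [warpedSpray, barInner_cons]
  simp only [mul_sub, Finset.sum_sub_distrib, barInner.eq_1 x, Finset.mul_sum]
  congr 1 <;> exact Finset.sum_congr rfl fun _ _ => by ring

/-- With `pz_mul_U_add`, this is the linear system whose solution by Cramer's rule is `U`, `V`. -/
theorem pz_pz_mul_U_add {z ρ : ℝ} (hρ : ρ ≠ 0) (h : Lam φ z ρ ≠ 0) :
    pz (pz φ) z ρ * U φ z ρ + pz φ z ρ * V φ z ρ = pr (pz φ) z ρ / (2 * ρ) := by
  rw [U, V]
  field_simp
  rw [Lam]
  ring

theorem pz_mul_U_add {z ρ : ℝ} (hρ : ρ ≠ 0) (h : Lam φ z ρ ≠ 0) :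
    pz φ z ρ * U φ z ρ + 2 * φ z ρ * V φ z ρ = pr φ z ρ / (2 * ρ) := by
  rw [U, V]
  field_simp
  rw [Lam]
  ring

theorem omega_mul_W {z ρ : ℝ} (hρ : ρ ≠ 0) (h : Omega φ z ρ ≠ 0) :
    Omega φ z ρ * W φ z ρ = pr φ z ρ / (2 * ρ) := by
  rw [W]
  field_simp

theorem IsWarped.spray_eq (hφ : IsWarped φ D S L) (hL : IsPseudoFinsler S L)
    (hv : v ∈ regularSet S) (hΩ : Omega φ (zVar v) (rhoVar v) ≠ 0) (c : Fin (n + 1)) :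
    spray L c v = warpedSpray φ v c := by
  have hα := hv.2.2.ne'
  have hρ : rhoVar v ≠ 0 := hv.2.1.ne'
  have hΛ := hφ.lam_ne_zero hL hv
  have e1 := pz_pz_mul_U_add hρ hΛ
  have e2 := pz_mul_U_add hρ hΛ
  have e3 := omega_mul_W hρ hΩ
  -- `W` cancels in the pairing with `ȳ`, so the equation of index `0` involves only `U` and `V`.
  have hy : barInner v.2 (warpedSpray φ v)
      = barNorm v.2 ^ 2 * (barInner v.1 v.2 * V φ (zVar v) (rhoVar v)) := by
    rw [barInner_warpedSpray, ← barNorm_sq, barInner_comm v.2 v.1]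
    ring
  refine hL.spray_eq hv.1 (fun a => ?_) c
  refine Fin.cases ?_ (fun k => ?_) a
  · rw [(hφ.hasDirDeriv_dY_zero hL hv _).2, (hφ.hasDirDeriv_dY_zero hL hv _).2, hφ.dX_zero hL hv]
    simp only [hy, barInner_zero_right, Pi.zero_apply]
    simp only [warpedSpray, Fin.cons_zero]
    field_simp at e1 ⊢
    linear_combination barNorm v.2 ^ 2 * barInner v.1 v.2 * e1
  · rw [(hφ.hasDirDeriv_dY_succ hL hv k _).2, (hφ.hasDirDeriv_dY_succ hL hv k _).2,
      hφ.dX_succ hL hv k]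
    simp only [hy, barInner_zero_right, Pi.zero_apply]
    simp only [warpedSpray, Fin.cons_zero, Fin.cons_succ]
    have hA : ∀ t, barNorm v.2 * barInner v.1 v.2 * t / barNorm v.2 = barInner v.1 v.2 * t := by
      intro t; field_simp
    have hB : ∀ t, zVar v * (barNorm v.2 ^ 2 * t) / barNorm v.2 ^ 2 = zVar v * t := by
      intro t; field_simp
    have h1 : ∀ t, pr (pz φ) (zVar v) (rhoVar v) * (t / rhoVar v)
        = 2 * t * (pz (pz φ) (zVar v) (rhoVar v) * U φ (zVar v) (rhoVar v)
          + pz φ (zVar v) (rhoVar v) * V φ (zVar v) (rhoVar v)) := by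
      intro t; rw [e1]; field_simp
    have h2 : ∀ t, pr φ (zVar v) (rhoVar v) * (t / rhoVar v)
        = 2 * t * (Omega φ (zVar v) (rhoVar v) * W φ (zVar v) (rhoVar v)) := by
      intro t; rw [e3]; field_simp
    -- Both sides equal `φ_ρ/(2ρ)`; this links `W` to `U` and `V` in the coefficient of `ȳ`.
    have h3 := e2.trans e3.symm
    rw [Omega] at h2 h3 ⊢
    rw [hA, hB]
    simp only [zero_div, mul_zero, sub_zero, zero_add, add_zero]
    linear_combination (zVar v * v.2 k.succ) * h1 (barInner v.1 v.2)
      - 2 * v.2 k.succ * h2 (barInner v.1 v.2) + barNorm v.2 ^ 2 * h2 (v.1 k.succ)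
      + 2 * barInner v.1 v.2 * v.2 k.succ * h3

end Lagrangian

/-! ### The Ricci curvature -/

section Curvature

variable {n : ℕ} {φ : ℝ → ℝ → ℝ} {D : Set (ℝ × ℝ)} {S : Set (TB n)} {L : TB n → ℝ} {v : TB n}

theorem IsWarped.lam_ne_zero_of_mem_regularDomain (hφ : IsWarped φ D S L)
    (hL : IsPseudoFinsler S L) (i : Fin n) {p : ℝ × ℝ} (hp : p ∈ regularDomain D) :
    Lam φ p.1 p.2 ≠ 0 := by
  have h := hφ.lam_ne_zero hL (hφ.testPoint_mem_regularSet (i := i) (j := i) hp)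
  rwa [zVar_testPoint, rhoVar_testPoint i i hp.2] at h

theorem SmoothOn₂.U {E : Set (ℝ × ℝ)} (hs : SmoothOn₂ φ E) (hE : IsOpen E)
    (h : ∀ p ∈ E, p.2 ≠ 0 ∧ Lam φ p.1 p.2 ≠ 0) : SmoothOn₂ (U φ) E := by
  have hz := hs.pz hE
  have hr := hs.pr hE
  have hzz := hz.pz hE
  have hzr := hz.pr hE
  unfold SmoothOn₂ at *
  unfold WarpedFinsler.U
  refine ContDiffOn.div (((contDiffOn_const.mul hs).mul hzr).sub (hz.mul hr))
    ((contDiffOn_const.mul contDiffOn_snd).mul (((contDiffOn_const.mul hs).mul hzz).sub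
      (hz.pow 2))) fun p hp => mul_ne_zero (mul_ne_zero two_ne_zero (h p hp).1) (h p hp).2

theorem SmoothOn₂.V {E : Set (ℝ × ℝ)} (hs : SmoothOn₂ φ E) (hE : IsOpen E)
    (h : ∀ p ∈ E, p.2 ≠ 0 ∧ Lam φ p.1 p.2 ≠ 0) : SmoothOn₂ (V φ) E := by
  have hz := hs.pz hE
  have hr := hs.pr hE
  have hzz := hz.pz hE
  have hzr := hz.pr hE
  unfold SmoothOn₂ at *
  unfold WarpedFinsler.V
  refine ContDiffOn.div ((hr.mul hzz).sub (hz.mul hzr))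
    ((contDiffOn_const.mul contDiffOn_snd).mul (((contDiffOn_const.mul hs).mul hzz).sub
      (hz.pow 2))) fun p hp => mul_ne_zero (mul_ne_zero two_ne_zero (h p hp).1) (h p hp).2

theorem SmoothOn₂.W {E : Set (ℝ × ℝ)} (hs : SmoothOn₂ φ E) (hE : IsOpen E)
    (h : ∀ p ∈ E, p.2 ≠ 0 ∧ Omega φ p.1 p.2 ≠ 0) : SmoothOn₂ (W φ) E := by
  have hz := hs.pz hE
  have hr := hs.pr hE
  unfold SmoothOn₂ at *
  unfold WarpedFinsler.W
  refine ContDiffOn.div hr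
    ((contDiffOn_const.mul contDiffOn_snd).mul ((contDiffOn_const.mul hs).sub
      (contDiffOn_fst.mul hz))) fun p hp => mul_ne_zero (mul_ne_zero two_ne_zero (h p hp).1)
        (h p hp).2

variable (n φ D S L) in
/-- A warped pseudo-Finsler metric for which `Ω` does not vanish. -/
structure IsRegularWarped : Prop where
  finsler : IsPseudoFinsler S L
  warped : IsWarped φ D S L
  omega_ne_zero : ∀ p ∈ regularDomain D, Omega φ p.1 p.2 ≠ 0

namespace IsRegularWarped

theorem smooth_U (h : IsRegularWarped n φ D S L) (hv : v ∈ regularSet S) :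
    SmoothOn₂ (U φ) (regularDomain D) :=
  let ⟨i⟩ := exists_index hv
  (h.warped.smooth_of_mem h.finsler hv).U (h.warped.isOpen_of_mem h.finsler hv) fun _ hp =>
    ⟨hp.2.ne', h.warped.lam_ne_zero_of_mem_regularDomain h.finsler i hp⟩

theorem smooth_V (h : IsRegularWarped n φ D S L) (hv : v ∈ regularSet S) :
    SmoothOn₂ (V φ) (regularDomain D) :=
  let ⟨i⟩ := exists_index hv
  (h.warped.smooth_of_mem h.finsler hv).V (h.warped.isOpen_of_mem h.finsler hv) fun _ hp =>
    ⟨hp.2.ne', h.warped.lam_ne_zero_of_mem_regularDomain h.finsler i hp⟩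

theorem smooth_W (h : IsRegularWarped n φ D S L) (hv : v ∈ regularSet S) :
    SmoothOn₂ (W φ) (regularDomain D) :=
  (h.warped.smooth_of_mem h.finsler hv).W (h.warped.isOpen_of_mem h.finsler hv) fun p hp =>
    ⟨hp.2.ne', h.omega_ne_zero p hp⟩

theorem spray_eq (h : IsRegularWarped n φ D S L) (hv : v ∈ regularSet S) (c : Fin (n + 1)) :
    spray L c v = warpedSpray φ v c :=
  h.warped.spray_eq h.finsler hv (h.omega_ne_zero _ (h.warped.mem_regularDomain hv)) c

/-! ### First derivatives of the spray coefficients -/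

theorem hasDirDeriv_spray_zero (h : IsRegularWarped n φ D S L) (hv : v ∈ regularSet S)
    (w : TB n) :
    HasDirDeriv (spray L 0) v w
      (barInner v.2 w.2 / barNorm v.2 * barInner v.1 v.2
          * (U φ (zVar v) (rhoVar v) + zVar v * V φ (zVar v) (rhoVar v))
        + barNorm v.2 * (barInner v.2 w.1 + barInner v.1 w.2)
          * (U φ (zVar v) (rhoVar v) + zVar v * V φ (zVar v) (rhoVar v))
        + barNorm v.2 * barInner v.1 v.2
          * ((pz (U φ) (zVar v) (rhoVar v) + V φ (zVar v) (rhoVar v)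
              + zVar v * pz (V φ) (zVar v) (rhoVar v))
              * (w.2 0 / barNorm v.2 - zVar v * barInner v.2 w.2 / barNorm v.2 ^ 2)
            + (pr (U φ) (zVar v) (rhoVar v) + zVar v * pr (V φ) (zVar v) (rhoVar v))
              * (barInner v.1 w.1 / rhoVar v))) := by
  have hL := h.finsler
  refine ((((hasDirDeriv_barNorm_snd w hv.2.2).mul (hasDirDeriv_barInner v w)).mul
    ((h.warped.hasDirDeriv hL (h.smooth_U hv) hv w).add ((hasDirDeriv_zVar w hv.2.2).mul
      (h.warped.hasDirDeriv hL (h.smooth_V hv) hv w)))).congr_on_regularSet hL.isOpen hv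
      fun u hu => (h.spray_eq hu 0).trans (by simp [warpedSpray])).congr_deriv ?_
  ring

theorem hasDirDeriv_spray_succ (h : IsRegularWarped n φ D S L) (hv : v ∈ regularSet S)
    (i : Fin n) (w : TB n) :
    HasDirDeriv (spray L i.succ) v w
      ((barInner v.2 w.1 + barInner v.1 w.2)
          * (V φ (zVar v) (rhoVar v) + W φ (zVar v) (rhoVar v)) * v.2 i.succ
        + barInner v.1 v.2 * ((pz (V φ) (zVar v) (rhoVar v) + pz (W φ) (zVar v) (rhoVar v))
              * (w.2 0 / barNorm v.2 - zVar v * barInner v.2 w.2 / barNorm v.2 ^ 2)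
            + (pr (V φ) (zVar v) (rhoVar v) + pr (W φ) (zVar v) (rhoVar v))
              * (barInner v.1 w.1 / rhoVar v)) * v.2 i.succ
        + barInner v.1 v.2 * (V φ (zVar v) (rhoVar v) + W φ (zVar v) (rhoVar v)) * w.2 i.succ
        - 2 * barInner v.2 w.2 * W φ (zVar v) (rhoVar v) * v.1 i.succ
        - barNorm v.2 ^ 2 * (pz (W φ) (zVar v) (rhoVar v)
              * (w.2 0 / barNorm v.2 - zVar v * barInner v.2 w.2 / barNorm v.2 ^ 2)
            + pr (W φ) (zVar v) (rhoVar v) * (barInner v.1 w.1 / rhoVar v)) * v.1 i.succ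
        - barNorm v.2 ^ 2 * W φ (zVar v) (rhoVar v) * w.1 i.succ) := by
  have hL := h.finsler
  have hα := hv.2.2.ne'
  have hW := h.warped.hasDirDeriv hL (h.smooth_W hv) hv w
  refine (((((hasDirDeriv_barInner v w).mul
    ((h.warped.hasDirDeriv hL (h.smooth_V hv) hv w).add hW)).mul
      (hasDirDeriv_snd_apply v w i.succ)).sub
      ((((hasDirDeriv_barNorm_snd w hv.2.2).pow_two).mul hW).mul
        (hasDirDeriv_fst_apply v w i.succ))).congr_on_regularSet hL.isOpen hv
      fun u hu => (h.spray_eq hu i.succ).trans (by simp [warpedSpray])).congr_deriv ?_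
  have hc : 2 * barNorm v.2 * (barInner v.2 w.2 / barNorm v.2) = 2 * barInner v.2 w.2 := by
    field_simp
  rw [hc]
  ring

theorem dX_spray_zero (h : IsRegularWarped n φ D S L) (hv : v ∈ regularSet S) :
    dX 0 (spray L 0) v = 0 := by
  rw [dX, (h.hasDirDeriv_spray_zero hv _).2]
  simp

theorem dX_spray_succ (h : IsRegularWarped n φ D S L) (hv : v ∈ regularSet S) (i : Fin n) :
    dX i.succ (spray L i.succ) v
      = (V φ (zVar v) (rhoVar v) + W φ (zVar v) (rhoVar v)) * (v.2 i.succ * v.2 i.succ)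
        + barInner v.1 v.2 / rhoVar v
          * (pr (V φ) (zVar v) (rhoVar v) + pr (W φ) (zVar v) (rhoVar v))
          * (v.1 i.succ * v.2 i.succ)
        - barNorm v.2 ^ 2 / rhoVar v * pr (W φ) (zVar v) (rhoVar v) * (v.1 i.succ * v.1 i.succ)
        - barNorm v.2 ^ 2 * W φ (zVar v) (rhoVar v) := by
  rw [dX, (h.hasDirDeriv_spray_succ hv i _).2]
  simp only [barInner_single_succ, barInner_zero_right, Pi.zero_apply, Pi.single_eq_same]
  ring

theorem dY_spray_zero_zero (h : IsRegularWarped n φ D S L) (hv : v ∈ regularSet S) :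
    dY 0 (spray L 0) v = barInner v.1 v.2 * (pz (U φ) (zVar v) (rhoVar v)
      + V φ (zVar v) (rhoVar v) + zVar v * pz (V φ) (zVar v) (rhoVar v)) := by
  have hα := hv.2.2.ne'
  rw [dY, (h.hasDirDeriv_spray_zero hv _).2]
  simp only [barInner_single_zero, barInner_zero_right, Pi.single_eq_same]
  field_simp
  ring

theorem dY_spray_zero_succ (h : IsRegularWarped n φ D S L) (hv : v ∈ regularSet S) (i : Fin n) :
    dY i.succ (spray L 0) v
      = barNorm v.2 * (U φ (zVar v) (rhoVar v) + zVar v * V φ (zVar v) (rhoVar v)) * v.1 i.succ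
        + barInner v.1 v.2 / barNorm v.2 * (U φ (zVar v) (rhoVar v)
          - zVar v * pz (U φ) (zVar v) (rhoVar v)
          - zVar v ^ 2 * pz (V φ) (zVar v) (rhoVar v)) * v.2 i.succ := by
  have hα := hv.2.2.ne'
  rw [dY, (h.hasDirDeriv_spray_zero hv _).2]
  simp only [barInner_single_succ, barInner_zero_right,
    Pi.single_eq_of_ne (Fin.succ_ne_zero i).symm]
  field_simp
  ring

theorem dY_spray_succ_zero (h : IsRegularWarped n φ D S L) (hv : v ∈ regularSet S) (i : Fin n) :
    dY 0 (spray L i.succ) v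
      = barInner v.1 v.2 / barNorm v.2
          * (pz (V φ) (zVar v) (rhoVar v) + pz (W φ) (zVar v) (rhoVar v)) * v.2 i.succ
        - barNorm v.2 * pz (W φ) (zVar v) (rhoVar v) * v.1 i.succ := by
  have hα := hv.2.2.ne'
  rw [dY, (h.hasDirDeriv_spray_succ hv i _).2]
  simp only [barInner_single_zero, barInner_zero_right, Pi.single_eq_same, Pi.zero_apply,
    Pi.single_eq_of_ne (Fin.succ_ne_zero i)]
  field_simp
  ring

theorem dY_spray_succ_succ (h : IsRegularWarped n φ D S L) (hv : v ∈ regularSet S)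
    (i j : Fin n) :
    dY j.succ (spray L i.succ) v
      = (if i = j then barInner v.1 v.2 * (V φ (zVar v) (rhoVar v) + W φ (zVar v) (rhoVar v))
          else 0)
        + (V φ (zVar v) (rhoVar v) + W φ (zVar v) (rhoVar v)) * (v.2 i.succ * v.1 j.succ)
        + -(barInner v.1 v.2 * zVar v / barNorm v.2 ^ 2
          * (pz (V φ) (zVar v) (rhoVar v) + pz (W φ) (zVar v) (rhoVar v)))
          * (v.2 i.succ * v.2 j.succ)
        + (zVar v * pz (W φ) (zVar v) (rhoVar v) - 2 * W φ (zVar v) (rhoVar v))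
          * (v.1 i.succ * v.2 j.succ) := by
  have hα := hv.2.2.ne'
  rw [dY, (h.hasDirDeriv_spray_succ hv i _).2]
  simp only [barInner_single_succ, barInner_zero_right, Pi.zero_apply,
    Pi.single_eq_of_ne (Fin.succ_ne_zero j).symm]
  have hs : (Pi.single j.succ 1 : Fin (n + 1) → ℝ) i.succ = if i = j then 1 else 0 := by
    simp [Pi.single_apply]
  rw [hs]
  split_ifs
  · field_simp
    ring
  · field_simp
    ring

end IsRegularWarped

/-! ### Trace identities -/

theorem sum_barInner_mul (x y : Fin (n + 1) → ℝ) (c : ℝ) :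
    ∑ i : Fin n, c * (x i.succ * y i.succ) = c * barInner x y :=
  (Finset.mul_sum _ _ _).symm

/-- The shape of the mixed products `∂G⁰/∂y^i · ∂G^i/∂y⁰`. -/
theorem sum_mul_eq_barInner (x y : Fin (n + 1) → ℝ) (a b c d : ℝ) :
    ∑ i : Fin n, (a * x i.succ + b * y i.succ) * (c * y i.succ - d * x i.succ)
      = a * c * barInner x y - a * d * barInner x x + b * c * barInner y y
        - b * d * barInner x y := by
  simp only [← sum_barInner_mul, ← Finset.sum_add_distrib, ← Finset.sum_sub_distrib]
  exact Finset.sum_congr rfl fun _ _ => by ring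

theorem trace_scalar_add_rank_two (x y : Fin (n + 1) → ℝ) (a b c d : ℝ) :
    ∑ i : Fin n, (a + b * (y i.succ * x i.succ)
      + c * (y i.succ * y i.succ) + d * (x i.succ * y i.succ))
      = n * a + (b + d) * barInner x y + c * barInner y y := by
  simp only [Finset.sum_add_distrib, sum_barInner_mul, barInner_comm y x]
  simp
  ring

theorem trace_sq_scalar_add_rank_two (x y : Fin (n + 1) → ℝ) (a b c d : ℝ) :
    ∑ i : Fin n, ∑ j : Fin n,
      ((if i = j then a else 0) + b * (y i.succ * x j.succ)
        + c * (y i.succ * y j.succ) + d * (x i.succ * y j.succ))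
      * ((if j = i then a else 0) + b * (y j.succ * x i.succ)
        + c * (y j.succ * y i.succ) + d * (x j.succ * y i.succ))
      = n * a ^ 2 + 2 * a * ((b + d) * barInner x y + c * barInner y y)
        + (b ^ 2 + d ^ 2) * barInner x y ^ 2 + c ^ 2 * barInner y y ^ 2
        + 2 * (b + d) * c * barInner x y * barInner y y
        + 2 * b * d * barInner x x * barInner y y := by
  have inner : ∀ i : Fin n, ∑ j : Fin n,
      ((if i = j then a else 0) + b * (y i.succ * x j.succ)
        + c * (y i.succ * y j.succ) + d * (x i.succ * y j.succ))
      * ((if j = i then a else 0) + b * (y j.succ * x i.succ)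
        + c * (y j.succ * y i.succ) + d * (x j.succ * y i.succ))
      = a ^ 2 + 2 * a * (b + d) * (x i.succ * y i.succ) + 2 * a * c * (y i.succ * y i.succ)
        + (b ^ 2 * barInner x y + b * c * barInner y y) * (x i.succ * y i.succ)
        + (b * c * barInner x y + b * d * barInner x x + c ^ 2 * barInner y y
          + c * d * barInner x y) * (y i.succ * y i.succ)
        + (d * c * barInner y y + d ^ 2 * barInner x y) * (x i.succ * y i.succ)
        + d * b * barInner y y * (x i.succ * x i.succ) := by
    intro i
    -- All Kronecker deltas are gathered into one term; the rest is sorted by its dependence on `j`.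
    have e : ∀ j : Fin n,
        ((if i = j then a else 0) + b * (y i.succ * x j.succ)
          + c * (y i.succ * y j.succ) + d * (x i.succ * y j.succ))
        * ((if j = i then a else 0) + b * (y j.succ * x i.succ)
          + c * (y j.succ * y i.succ) + d * (x j.succ * y i.succ))
        = (if i = j then a ^ 2 + 2 * a * (b + d) * (x i.succ * y i.succ)
            + 2 * a * c * (y i.succ * y i.succ) else 0)
          + (b * y i.succ * (b * x i.succ + c * y i.succ)
            + (c * y i.succ + d * x i.succ) * d * y i.succ) * (x j.succ * y j.succ)
          + (c * y i.succ + d * x i.succ) * (b * x i.succ + c * y i.succ)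
            * (y j.succ * y j.succ)
          + b * d * y i.succ * y i.succ * (x j.succ * x j.succ) := by
      intro j
      by_cases hij : i = j
      · subst hij
        simp only [if_true]
        ring
      · rw [if_neg hij, if_neg (Ne.symm hij), if_neg hij]
        ring
    simp only [e, Finset.sum_add_distrib, sum_barInner_mul, Finset.sum_ite_eq, Finset.mem_univ,
      if_true]
    ring
  simp only [inner, Finset.sum_add_distrib, sum_barInner_mul]
  simp
  ring

namespace IsRegularWarped

/-- The `V_z` and `W_z` terms of index `0` and of the spatial block cancel, so `U_z` is the only
derivative left in the divergence. -/
theorem sum_dY_spray (h : IsRegularWarped n φ D S L) (hv : v ∈ regularSet S) :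
    ∑ c, dY c (spray L c) v = barInner v.1 v.2 * (pz (U φ) (zVar v) (rhoVar v)
      + (n + 2) * V φ (zVar v) (rhoVar v) + (n - 1) * W φ (zVar v) (rhoVar v)) := by
  have hα := hv.2.2.ne'
  rw [Fin.sum_univ_succ, h.dY_spray_zero_zero hv]
  simp only [h.dY_spray_succ_succ hv, if_true]
  rw [trace_scalar_add_rank_two, ← barNorm_sq]
  field_simp
  ring

theorem hasDirDeriv_sum_dY_spray (h : IsRegularWarped n φ D S L) (hv : v ∈ regularSet S)
    (w : TB n) :
    HasDirDeriv (fun u => ∑ c, dY c (spray L c) u) v w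
      ((barInner v.2 w.1 + barInner v.1 w.2) * (pz (U φ) (zVar v) (rhoVar v)
        + (n + 2) * V φ (zVar v) (rhoVar v) + (n - 1) * W φ (zVar v) (rhoVar v))
      + barInner v.1 v.2
        * ((pz (pz (U φ)) (zVar v) (rhoVar v) + (n + 2) * pz (V φ) (zVar v) (rhoVar v)
              + (n - 1) * pz (W φ) (zVar v) (rhoVar v))
            * (w.2 0 / barNorm v.2 - zVar v * barInner v.2 w.2 / barNorm v.2 ^ 2)
          + (pr (pz (U φ)) (zVar v) (rhoVar v) + (n + 2) * pr (V φ) (zVar v) (rhoVar v)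
              + (n - 1) * pr (W φ) (zVar v) (rhoVar v)) * (barInner v.1 w.1 / rhoVar v))) := by
  have hL := h.finsler
  have hE := h.warped.isOpen_of_mem hL hv
  refine (((hasDirDeriv_barInner v w).mul
    (((h.warped.hasDirDeriv hL ((h.smooth_U hv).pz hE) hv w).add
      ((HasDirDeriv.const ((n : ℝ) + 2)).mul
        (h.warped.hasDirDeriv hL (h.smooth_V hv) hv w))).add
      ((HasDirDeriv.const ((n : ℝ) - 1)).mul
        (h.warped.hasDirDeriv hL (h.smooth_W hv) hv w)))).congr_on_regularSet hL.isOpen hv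
      fun u hu => h.sum_dY_spray hu).congr_deriv ?_
  ring

theorem sum_dX_spray (h : IsRegularWarped n φ D S L) (hv : v ∈ regularSet S) :
    ∑ c, dX c (spray L c) v
      = barNorm v.2 ^ 2 * (V φ (zVar v) (rhoVar v) + W φ (zVar v) (rhoVar v)
          - n * W φ (zVar v) (rhoVar v) - rhoVar v * pr (W φ) (zVar v) (rhoVar v))
        + barInner v.1 v.2 ^ 2 / rhoVar v
          * (pr (V φ) (zVar v) (rhoVar v) + pr (W φ) (zVar v) (rhoVar v)) := by
  have hρ : rhoVar v ≠ 0 := hv.2.1.ne'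
  have hx : barInner v.1 v.1 = rhoVar v ^ 2 := (barNorm_sq v.1).symm
  rw [Fin.sum_univ_succ, h.dX_spray_zero hv]
  simp only [h.dX_spray_succ hv, Finset.sum_add_distrib, Finset.sum_sub_distrib, sum_barInner_mul]
  rw [← barNorm_sq v.2, hx]
  simp
  field_simp
  ring

theorem sum_sum_dY_spray_mul (h : IsRegularWarped n φ D S L) (hv : v ∈ regularSet S) :
    ∑ c, ∑ a, dY a (spray L c) v * dY c (spray L a) v
      = barInner v.1 v.2 ^ 2 * ((pz (U φ) (zVar v) (rhoVar v) + V φ (zVar v) (rhoVar v)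
            + zVar v * pz (V φ) (zVar v) (rhoVar v)) ^ 2
          + n * (V φ (zVar v) (rhoVar v) + W φ (zVar v) (rhoVar v)) ^ 2
          + 2 * (V φ (zVar v) (rhoVar v) + W φ (zVar v) (rhoVar v))
            * (V φ (zVar v) (rhoVar v) - W φ (zVar v) (rhoVar v)
              - zVar v * pz (V φ) (zVar v) (rhoVar v))
          + (V φ (zVar v) (rhoVar v) + W φ (zVar v) (rhoVar v)) ^ 2
          + (zVar v * pz (W φ) (zVar v) (rhoVar v) - 2 * W φ (zVar v) (rhoVar v)) ^ 2
          + zVar v ^ 2 * (pz (V φ) (zVar v) (rhoVar v) + pz (W φ) (zVar v) (rhoVar v)) ^ 2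
          - 2 * (V φ (zVar v) (rhoVar v) - W φ (zVar v) (rhoVar v)
              + zVar v * pz (W φ) (zVar v) (rhoVar v))
            * (zVar v * (pz (V φ) (zVar v) (rhoVar v) + pz (W φ) (zVar v) (rhoVar v)))
          + 2 * (U φ (zVar v) (rhoVar v) + zVar v * V φ (zVar v) (rhoVar v))
            * (pz (V φ) (zVar v) (rhoVar v) + pz (W φ) (zVar v) (rhoVar v))
          + 2 * (U φ (zVar v) (rhoVar v) - zVar v * pz (U φ) (zVar v) (rhoVar v)
              - zVar v ^ 2 * pz (V φ) (zVar v) (rhoVar v)) * pz (V φ) (zVar v) (rhoVar v))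
        + 2 * barNorm v.2 ^ 2 * rhoVar v ^ 2
          * ((V φ (zVar v) (rhoVar v) + W φ (zVar v) (rhoVar v))
              * (zVar v * pz (W φ) (zVar v) (rhoVar v) - 2 * W φ (zVar v) (rhoVar v))
            - (U φ (zVar v) (rhoVar v) + zVar v * V φ (zVar v) (rhoVar v))
              * pz (W φ) (zVar v) (rhoVar v)) := by
  have hα := hv.2.2.ne'
  have hx : barInner v.1 v.1 = rhoVar v ^ 2 := (barNorm_sq v.1).symm
  rw [Fin.sum_univ_succ]
  simp only [Fin.sum_univ_succ (n := n), Finset.sum_add_distrib (s := Finset.univ (α := Fin n))]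
  -- Gives both mixed sums the same factor order, so that one rewrite by `sum_mul_eq_barInner`
  -- handles both.
  simp only [mul_comm (dY 0 (spray L (Fin.succ _)) v)]
  simp only [h.dY_spray_succ_succ hv, h.dY_spray_succ_zero hv, h.dY_spray_zero_succ hv,
    h.dY_spray_zero_zero hv]
  rw [sum_mul_eq_barInner, trace_sq_scalar_add_rank_two, hx, ← barNorm_sq]
  field_simp
  ring

end IsRegularWarped

/-- After tracing, the contractions with `y` and `G` differentiate the divergence along `(y, 0)` and
`(0, G)`; no derivatives need to be interchanged. -/
theorem IsPseudoFinsler.ricci_eq (hL : IsPseudoFinsler S L) (hv : v ∈ S) :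
    ricci L v = 2 * ∑ c, dX c (spray L c) v
      - fderiv ℝ (fun u => ∑ c, dY c (spray L c) u) v (v.2, 0)
      + 2 * fderiv ℝ (fun u => ∑ c, dY c (spray L c) u) v (0, fun a => spray L a v)
      - ∑ c, ∑ a, dY a (spray L c) v * dY c (spray L a) v := by
  have hd : ∀ c, DifferentiableAt ℝ (dY c (spray L c)) v := fun c =>
    ((contDiffOn_dY hL.isOpen (hL.contDiffOn_spray c) c).contDiffAt
      (hL.isOpen.mem_nhds hv)).differentiableAt (by simp)
  rw [fderiv_fun_sum fun c _ => hd c]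
  simp only [sum_apply, ← sum_dX_mul, ← sum_dY_mul, ricci, flagCurv,
    Finset.sum_add_distrib, Finset.sum_sub_distrib, ← Finset.mul_sum]
  simp only [mul_comm (spray L _ v)]

theorem IsRegularWarped.ricci_eq (h : IsRegularWarped n φ D S L) (hv : v ∈ regularSet S) :
    ricci L v = P n φ (zVar v) (rhoVar v) * barNorm v.2 ^ 2
      + Q n φ (zVar v) (rhoVar v) * barInner v.1 v.2 ^ 2 := by
  have hα := hv.2.2.ne'
  have hρ : rhoVar v ≠ 0 := hv.2.1.ne'
  have hx : barInner v.1 v.1 = rhoVar v ^ 2 := (barNorm_sq v.1).symm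
  have hG : (fun a => spray L a v) = warpedSpray φ v := funext (h.spray_eq hv)
  have hG0 : warpedSpray φ v 0 = barNorm v.2 * barInner v.1 v.2
      * (U φ (zVar v) (rhoVar v) + zVar v * V φ (zVar v) (rhoVar v)) := by simp [warpedSpray]
  rw [h.finsler.ricci_eq hv.1, h.sum_dX_spray hv, h.sum_sum_dY_spray_mul hv,
    (h.hasDirDeriv_sum_dY_spray hv _).2, (h.hasDirDeriv_sum_dY_spray hv _).2, hG]
  simp only [barInner_warpedSpray, barInner_zero_right, Pi.zero_apply, hG0, ← barNorm_sq v.2, hx,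
    barInner_comm v.2 v.1, P, Q]
  field_simp
  ring

/-! ### Ricci-flatness -/

/-- `S` may contain points with `x̄ = 0` or `ȳ = 0`, where the formula is unavailable; density and
continuity cover them. -/
theorem isRicciFlat_iff_regularSet (hL : IsPseudoFinsler S L) (i : Fin n) :
    IsRicciFlat S L ↔ ∀ v ∈ regularSet S, ricci L v = 0 := by
  refine ⟨fun h v hv => h v hv.1, fun h v hv => ?_⟩
  have hc : ContinuousWithinAt (ricci L) (regularSet S) v :=
    (hL.contDiffOn_ricci.continuousOn v hv).mono fun _ hu => hu.1
  have := mem_closure_iff_nhdsWithin_neBot.1 (regularSet_dense hL.isOpen i hv)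
  exact tendsto_nhds_unique hc (tendsto_const_nhds.congr'
    (eventually_mem_nhdsWithin.mono fun u hu => (h u hu).symm))

theorem IsRegularWarped.ricci_testPoint (h : IsRegularWarped n φ D S L) (i j : Fin n)
    {p : ℝ × ℝ} (hp : p ∈ regularDomain D) :
    ricci L (testPoint i j p)
      = P n φ p.1 p.2 + Q n φ p.1 p.2 * (if i = j then p.2 else 0) ^ 2 := by
  rw [h.ricci_eq (h.warped.testPoint_mem_regularSet hp), zVar_testPoint,
    rhoVar_testPoint i j hp.2, barNorm_testPoint_snd, barInner_testPoint]
  ring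

theorem IsRegularWarped.isRicciFlat_iff (h : IsRegularWarped n φ D S L) (hn : 2 ≤ n) :
    IsRicciFlat S L ↔ ∀ p ∈ regularDomain D, P n φ p.1 p.2 = 0 ∧ Q n φ p.1 p.2 = 0 := by
  let i : Fin n := ⟨0, by omega⟩
  let j : Fin n := ⟨1, by omega⟩
  have hij : i ≠ j := by simp [i, j]
  rw [isRicciFlat_iff_regularSet h.finsler i]
  constructor
  · intro hR p hp
    -- Orthogonal `x̄, ȳ` isolate `P`; the parallel pair gives `P + ρ²Q`, and `ρ > 0` yields `Q =
    -- 0`.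
    have h1 := h.ricci_testPoint i j hp
    have h2 := h.ricci_testPoint i i hp
    rw [hR _ (h.warped.testPoint_mem_regularSet hp), if_neg hij] at h1
    rw [hR _ (h.warped.testPoint_mem_regularSet hp), if_pos rfl] at h2
    have hP : P n φ p.1 p.2 = 0 := by linarith
    refine ⟨hP, ?_⟩
    rw [hP, zero_add] at h2
    exact (mul_eq_zero.1 h2.symm).resolve_right (pow_ne_zero 2 hp.2.ne')
  · intro hPQ v hv
    obtain ⟨h1, h2⟩ := hPQ _ (h.warped.mem_regularDomain hv)
    rw [h.ricci_eq hv, h1, h2]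
    ring

theorem IsRegularWarped.isRicciFlat_iff_one {S : Set (TB 1)} {L : TB 1 → ℝ}
    (h : IsRegularWarped 1 φ D S L) :
    IsRicciFlat S L ↔ ∀ p ∈ regularDomain D, P 1 φ p.1 p.2 + p.2 ^ 2 * Q 1 φ p.1 p.2 = 0 := by
  rw [isRicciFlat_iff_regularSet h.finsler 0]
  constructor
  · intro hR p hp
    have h1 := h.ricci_testPoint 0 0 hp
    rw [hR _ (h.warped.testPoint_mem_regularSet hp), if_pos rfl] at h1
    linarith
  · intro hPQ v hv
    have h1 := hPQ _ (h.warped.mem_regularDomain hv)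
    -- Equality in Cauchy–Schwarz, automatic in dimension one.
    have h2 : barInner v.1 v.2 ^ 2 = rhoVar v ^ 2 * barNorm v.2 ^ 2 := by
      rw [rhoVar, barNorm_sq, barNorm_sq]
      simp [barInner]
      ring
    rw [h.ricci_eq hv, h2]
    linear_combination barNorm v.2 ^ 2 * h1

end Curvature

end WarpedFinsler

theorem theorem1 (n : ℕ) (hn : 1 ≤ n) (φ : ℝ → ℝ → ℝ) (D : Set (ℝ × ℝ)) (S : Set (TB n))
    (L : TB n → ℝ) (hL : IsPseudoFinsler S L) (hφ : IsWarped φ D S L)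
    (hΩ : n = 1 → ∀ z ρ : ℝ, (z, ρ) ∈ D → 0 < ρ → Omega φ z ρ ≠ 0) :
    (∀ v ∈ S, 0 < barNorm v.1 → 0 < barNorm v.2 →
      ricci L v = P n φ (zVar v) (rhoVar v) * barNorm v.2 ^ 2
        + Q n φ (zVar v) (rhoVar v) * barInner v.1 v.2 ^ 2) ∧
    (2 ≤ n → (IsRicciFlat S L ↔
      ∀ z ρ : ℝ, (z, ρ) ∈ D → 0 < ρ → P n φ z ρ = 0 ∧ Q n φ z ρ = 0)) ∧
    (n = 1 → (IsRicciFlat S L ↔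
      ∀ z ρ : ℝ, (z, ρ) ∈ D → 0 < ρ → P n φ z ρ + ρ ^ 2 * Q n φ z ρ = 0)) := by
  -- `Ω ≠ 0` is the extra assumption when `n = 1` and follows from non-degeneracy when `n ≥ 2`.
  have h : IsRegularWarped n φ D S L := ⟨hL, hφ, fun p hp => by
    rcases hn.eq_or_lt with h1 | h2
    · exact hΩ h1.symm p.1 p.2 hp.1 hp.2
    · exact hφ.omega_ne_zero hL h2 hp⟩
  refine ⟨fun v hv h1 h2 => h.ricci_eq ⟨hv, h1, h2⟩, fun h2 => ?_, fun h1 => ?_⟩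
  · rw [h.isRicciFlat_iff h2]
    exact ⟨fun H z ρ hD hρ => H (z, ρ) ⟨hD, hρ⟩, fun H p hp => H p.1 p.2 hp.1 hp.2⟩
  · subst h1
    rw [h.isRicciFlat_iff_one]
    exact ⟨fun H z ρ hD hρ => H (z, ρ) ⟨hD, hρ⟩, fun H p hp => H p.1 p.2 hp.1 hp.2⟩
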